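/- Fix $\ell>0$. For each $d\ge 1$ let $h_d=\ell^2 d^{-1/3}$, let $p(\mathbf x)=\prod_{i=1}^d\phi(x_i)$, $\phi(u)=(2\pi)^{-1/2}e^{-u^2/2}$, be the standard Gaussian density on $\mathbb R^d$, and let $q(\cdot\mid\mathbf x)$ be the density of $\mathcal N\big(\mathbf x+\tfrac{h_d}{2}\nabla\log p(\mathbf x),\,h_d\mathbf I\big)$. Let $\mathbf x,\mathbf z\sim\mathcal N(\mathbf 0,\mathbf I)$ on $\mathbb R^d$ and $U\sim\mathcal U([0,1])$ be independent, let $$\tilde{\mathbf x}=\mathbf x+\tfrac{h_d}{2}\nabla\log p(\mathbf x)+\sqrt{h_d}\,\mathbf z,\qquad W_d=\log\frac{p(\tilde{\mathbf x})\,q(\mathbf x\mid\tilde{\mathbf x})}{p(\mathbf x)\,q(\tilde{\mathbf x}\mid\mathbf x)},\qquad \alpha_d(\mathbf x,\tilde{\mathbf x})=\frac1{1+e^{-W_d}},$$ and let $\mathbf x'$ be the next state of the Barker-adjusted Langevin chain: $\mathbf x'=\tilde{\mathbf x}$ if $U\le\alpha_d(\mathbf x,\tilde{\mathbf x})$ and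 $\mathbf x'=\mathbf x$ otherwise. Let $\mathrm{ESJD}_d=\mathbb E\big[\|\mathbf x'-\mathbf x\|^2\big]$ be its expected squared jump distance in stationarity. Then: 1. as $d\to\infty$, $W_d$ converges in distribution to $\mathcal N\big(-\tfrac{\ell^6}{32},\tfrac{\ell^6}{16}\big)$; 2. $\mathrm{ESJD}_d=\mathbb E\big[\|\mathbf x-\tilde{\mathbf x}\|^2\,\alpha_d(\mathbf x,\tilde{\mathbf x})\big]$ for every $d$, and $$\lim_{d\to\infty}d^{-2/3}\,\mathrm{ESJD}_d=\ell^2A(\ell),\qquad A(\ell):=\mathbb E\left[\frac1{1+e^{-W}}\right],$$ where $W\sim\mathcal N(-\sigma^2/2,\sigma^2)$ and $\sigma^2=\ell^6/16$. -/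

import Mathlib

open MeasureTheory ProbabilityTheory Filter Topology

noncomputable section

/-- The standard Gaussian density `p(x) = ∏ᵢ φ(xᵢ)` on `ℝᵈ`, with respect to Lebesgue measure. -/
def stdGaussianDensity (d : ℕ) (x : EuclideanSpace ℝ (Fin d)) : ℝ :=
  ∏ i, gaussianPDFReal 0 1 (x i)

/-- The exact score `s = ∇ log p` of a density `p`. -/
def exactScore {d : ℕ} (p : EuclideanSpace ℝ (Fin d) → ℝ) (x : EuclideanSpace ℝ (Fin d)) :
    EuclideanSpace ℝ (Fin d) :=
  gradient (fun y => Real.log (p y)) x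

/-- The ULA proposal `x̃ = x + (h/2) ∇ log p(x) + √h z` from the state `x` with noise `z`. -/
def ulaProposal {d : ℕ} (p : EuclideanSpace ℝ (Fin d) → ℝ) (h : ℝ)
    (x z : EuclideanSpace ℝ (Fin d)) : EuclideanSpace ℝ (Fin d) :=
  x + (h / 2) • exactScore p x + √h • z

/-- The ULA proposal density `q(y | x)`, i.e. the density at `y` of
`N(x + (h/2) ∇ log p(x), h I)`. -/
def ulaDensity {d : ℕ} (p : EuclideanSpace ℝ (Fin d) → ℝ) (h : ℝ)
    (x y : EuclideanSpace ℝ (Fin d)) : ℝ :=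
  ∏ i, gaussianPDFReal ((x + (h / 2) • exactScore p x) i) h.toNNReal (y i)

/-- The log-acceptance ratio `log (p(y) q(x | y) / (p(x) q(y | x)))`. -/
def logAcceptanceRatio {d : ℕ} (p : EuclideanSpace ℝ (Fin d) → ℝ) (h : ℝ)
    (x y : EuclideanSpace ℝ (Fin d)) : ℝ :=
  Real.log (p y * ulaDensity p h y x / (p x * ulaDensity p h x y))

/-- Barker's function `g(w) = 1 / (1 + exp(-w))`. -/
def barkerFun (w : ℝ) : ℝ := 1 / (1 + Real.exp (-w))

/-- Barker's acceptance probability of the move from `x` to `y`. -/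
def barkerAcceptance {d : ℕ} (p : EuclideanSpace ℝ (Fin d) → ℝ) (h : ℝ)
    (x y : EuclideanSpace ℝ (Fin d)) : ℝ :=
  barkerFun (logAcceptanceRatio p h x y)

/-- One step of the Barker-adjusted Langevin chain: from `x`, propose with noise `z`, and accept
if and only if the uniform variable `u` is at most the acceptance probability. -/
def barkerStep {d : ℕ} (p : EuclideanSpace ℝ (Fin d) → ℝ) (h : ℝ)
    (x z : EuclideanSpace ℝ (Fin d)) (u : ℝ) : EuclideanSpace ℝ (Fin d) :=
  if u ≤ barkerAcceptance p h x (ulaProposal p h x z) then ulaProposal p h x z else x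

/-- The expected squared jump distance `E ‖X' - X‖²` between consecutive states `X`, `X'`. -/
def expectedSqJump {Ω : Type*} [MeasurableSpace Ω] (P : Measure Ω) {d : ℕ}
    (X X' : Ω → EuclideanSpace ℝ (Fin d)) : ℝ :=
  ∫ ω, ‖X' ω - X ω‖ ^ 2 ∂P

/-- The step size `h_d = ℓ² d^{-1/3}`. -/
def stepSize (ℓ : ℝ) (d : ℕ) : ℝ := ℓ ^ 2 * (d : ℝ) ^ (-(1 / 3) : ℝ)

/-- `A(ℓ) = E[1 / (1 + exp(-W))]` for `W ∼ N(-σ²/2, σ²)` with `σ² = ℓ⁶/16`. -/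
def limitAcceptance (ℓ : ℝ) : ℝ :=
  ∫ w, barkerFun w ∂(gaussianReal (-(ℓ ^ 6 / 16) / 2) (ℓ ^ 6 / 16).toNNReal)

end

/-!
Write `y = (1 - h/2) x + √h z` for the proposal; the score of the standard Gaussian is `-x`. All
densities are Gaussian, so the log-acceptance ratio is exactly

  `W = (h/8) (‖x‖² - ‖y‖²)
     = (h²/8) (‖x‖² - ‖z‖²) - (h³/32) ‖x‖² - (h/4) (1 - h/2) √h ⟪x, z⟫`.

The variance of `‖x‖²` is proportional to `d`, and `h³ d = ℓ⁶`. Hence the first term has size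
`h² √d → 0`, the second is `-ℓ⁶/32` up to `h³ √d → 0`, and the third is, given `x`, a centred
Gaussian of variance `h³ (1 - h/2)² ‖x‖² / 16`, which concentrates at `ℓ⁶/16`. These bounds hold in
`L¹`, so they pass to characteristic functions (`norm_charFun_logAcceptanceRatio_sub_le`), and
Lévy's continuity theorem gives the limit law (`tendstoInDistribution_logAcceptanceRatio`).

For the jump distance, the uniform variable is independent of `(x, z)` and integrates out by Fubini
(`expectedSqJump_barkerStep`). Since `d^{-2/3} = h² / ℓ⁴`, the rescaled squared distance
`d^{-2/3} ‖x - y‖²` converges to `ℓ²` in `L¹` (`integral_abs_norm_sq_ulaProposal_sub_le`). Barker's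
function is bounded and continuous, so the mean acceptance probability converges to its mean under
the limit law, and the product of the two limits is the claimed one.
-/

/-! ### The Barker log-ratio for a standard Gaussian target -/

/-- The density of `N(m, v I)` on `ℝᵈ`, written as a product of one-dimensional densities. -/
lemma prod_gaussianPDFReal {d : ℕ} (m y : EuclideanSpace ℝ (Fin d)) (v : NNReal) :
    ∏ i, gaussianPDFReal (m i) v (y i) =
      (√(2 * Real.pi * v))⁻¹ ^ d * Real.exp (-‖y - m‖ ^ 2 / (2 * v)) := by
  simp only [gaussianPDFReal, Finset.prod_mul_distrib, Finset.prod_const, Finset.card_univ,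
    Fintype.card_fin, ← Real.exp_sum, EuclideanSpace.real_norm_sq_eq, PiLp.sub_apply]
  rw [← Finset.sum_div, Finset.sum_neg_distrib]

lemma stdGaussianDensity_eq {d : ℕ} (x : EuclideanSpace ℝ (Fin d)) :
    stdGaussianDensity d x = (√(2 * Real.pi))⁻¹ ^ d * Real.exp (-‖x‖ ^ 2 / 2) := by
  simpa [stdGaussianDensity] using prod_gaussianPDFReal 0 x 1

lemma exactScore_stdGaussianDensity {d : ℕ} (x : EuclideanSpace ℝ (Fin d)) :
    exactScore (stdGaussianDensity d) x = -x := by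
  have hlog : (fun y => Real.log (stdGaussianDensity d y)) =
      fun y => Real.log ((√(2 * Real.pi))⁻¹ ^ d) + (-(1 / 2) : ℝ) * ‖y‖ ^ 2 := by
    funext y
    rw [stdGaussianDensity_eq, Real.log_mul (by positivity) (Real.exp_ne_zero _), Real.log_exp]
    ring
  have hgrad : HasGradientAt (fun y => Real.log (stdGaussianDensity d y)) (-x) x := by
    rw [hasGradientAt_iff_hasFDerivAt, hlog]
    have h := ((hasStrictFDerivAt_norm_sq x).hasFDerivAt.const_mul (-(1 / 2) : ℝ)).const_add
      (Real.log ((√(2 * Real.pi))⁻¹ ^ d))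
    refine h.congr_fderiv ?_
    ext y
    simp
  exact hgrad.gradient

lemma ulaProposal_stdGaussianDensity {d : ℕ} (h : ℝ) (x z : EuclideanSpace ℝ (Fin d)) :
    ulaProposal (stdGaussianDensity d) h x z = (1 - h / 2) • x + √h • z := by
  rw [ulaProposal, exactScore_stdGaussianDensity]
  module

/-- For a standard Gaussian target the log-acceptance ratio depends on the two states only through
the difference of their squared norms. -/
lemma logAcceptanceRatio_stdGaussianDensity {d : ℕ} {h : ℝ} (hh : 0 < h)
    (x y : EuclideanSpace ℝ (Fin d)) :
    logAcceptanceRatio (stdGaussianDensity d) h x y = h / 8 * (‖x‖ ^ 2 - ‖y‖ ^ 2) := by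
  have hula (a b : EuclideanSpace ℝ (Fin d)) : ulaDensity (stdGaussianDensity d) h a b =
      (√(2 * Real.pi * h))⁻¹ ^ d * Real.exp (-‖b - (1 - h / 2) • a‖ ^ 2 / (2 * h)) := by
    rw [ulaDensity, exactScore_stdGaussianDensity, prod_gaussianPDFReal, Real.coe_toNNReal _ hh.le]
    congr 6
    module
  rw [logAcceptanceRatio, hula, hula, stdGaussianDensity_eq, stdGaussianDensity_eq,
    Real.log_div (by positivity) (by positivity)]
  simp only [Real.log_mul (show (√(2 * Real.pi))⁻¹ ^ d * Real.exp _ ≠ 0 by positivity)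
    (show (√(2 * Real.pi * h))⁻¹ ^ d * Real.exp _ ≠ 0 by positivity),
    Real.log_mul (show (√(2 * Real.pi))⁻¹ ^ d ≠ 0 by positivity) (Real.exp_ne_zero _),
    Real.log_mul (show (√(2 * Real.pi * h))⁻¹ ^ d ≠ 0 by positivity) (Real.exp_ne_zero _),
    Real.log_exp, norm_sub_sq_real, norm_smul, mul_pow, Real.norm_eq_abs, sq_abs,
    inner_smul_right, real_inner_comm x y]
  field_simp
  ring

lemma stepSize_nonneg (ℓ : ℝ) (d : ℕ) : 0 ≤ stepSize ℓ d := by unfold stepSize; positivity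

lemma stepSize_pos {ℓ : ℝ} (hℓ : 0 < ℓ) {d : ℕ} (hd : 0 < d) : 0 < stepSize ℓ d := by
  unfold stepSize; positivity

/-- The formula for the log-acceptance ratio at the step size `h_d`; in dimension `0`, where
`h_d = 0`, both sides vanish. -/
lemma logAcceptanceRatio_stepSize {ℓ : ℝ} (hℓ : 0 < ℓ) {d : ℕ}
    (x y : EuclideanSpace ℝ (Fin d)) :
    logAcceptanceRatio (stdGaussianDensity d) (stepSize ℓ d) x y =
      stepSize ℓ d / 8 * (‖x‖ ^ 2 - ‖y‖ ^ 2) := by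
  rcases Nat.eq_zero_or_pos d with rfl | hd
  · simp [logAcceptanceRatio, stdGaussianDensity, ulaDensity, Subsingleton.elim x y]
  · exact logAcceptanceRatio_stdGaussianDensity (stepSize_pos hℓ hd) x y

lemma norm_sq_ulaProposal {d : ℕ} {h : ℝ} (hh : 0 ≤ h) (x z : EuclideanSpace ℝ (Fin d)) :
    ‖ulaProposal (stdGaussianDensity d) h x z‖ ^ 2 =
      (1 - h / 2) ^ 2 * ‖x‖ ^ 2 + 2 * (1 - h / 2) * √h * inner ℝ x z + h * ‖z‖ ^ 2 := by
  rw [ulaProposal_stdGaussianDensity, norm_add_sq_real]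
  simp only [norm_smul, mul_pow, Real.norm_eq_abs, sq_abs, inner_smul_left, inner_smul_right,
    Real.sq_sqrt hh, RCLike.conj_to_real]
  ring

lemma norm_sq_ulaProposal_sub {d : ℕ} {h : ℝ} (hh : 0 ≤ h) (x z : EuclideanSpace ℝ (Fin d)) :
    ‖x - ulaProposal (stdGaussianDensity d) h x z‖ ^ 2 =
      h ^ 2 / 4 * ‖x‖ ^ 2 - h * √h * inner ℝ x z + h * ‖z‖ ^ 2 := by
  have hsub : x - ulaProposal (stdGaussianDensity d) h x z = (h / 2) • x - √h • z := by
    rw [ulaProposal_stdGaussianDensity]; module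
  rw [hsub, norm_sub_sq_real]
  simp only [norm_smul, mul_pow, Real.norm_eq_abs, sq_abs, inner_smul_left, inner_smul_right,
    Real.sq_sqrt hh, RCLike.conj_to_real]
  ring

/-! ### Moments of the standard Gaussian vector -/

/-- The variance of the square of a standard Gaussian variable. -/
noncomputable def gaussianSqVar : ℝ := Var[fun u : ℝ => u ^ 2; gaussianReal 0 1]

lemma memLp_sq_gaussianReal : MemLp (fun u : ℝ => u ^ 2) 2 (gaussianReal 0 1) := by
  have h := (memLp_id_gaussianReal' (μ := 0) (v := 1) 4 (by simp))
  have h2 := h.norm_rpow_div (2 : ENNReal)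
  have e : (4 / 2 : ENNReal) = 2 := by
    rw [show (4 : ENNReal) = 2 * 2 by norm_num, ENNReal.mul_div_cancel_right (by simp) (by simp)]
  simpa [e] using h2

lemma integral_sq_gaussianReal : ∫ u : ℝ, u ^ 2 ∂(gaussianReal 0 1) = 1 := by
  have h := variance_eq_sub (memLp_id_gaussianReal' (μ := 0) (v := 1) 2 (by simp))
  simpa using h.symm

lemma memLp_norm_sq_stdGaussian (d : ℕ) :
    MemLp (fun x : EuclideanSpace ℝ (Fin d) => ‖x‖ ^ 2) 2 (stdGaussian _) := by
  have h := (IsGaussian.memLp_id (stdGaussian (EuclideanSpace ℝ (Fin d))) 4 (by simp))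
  have h2 := h.norm_rpow_div (2 : ENNReal)
  have e : (4 / 2 : ENNReal) = 2 := by
    rw [show (4 : ENNReal) = 2 * 2 by norm_num, ENNReal.mul_div_cancel_right (by simp) (by simp)]
  simpa [e] using h2

lemma integral_norm_sq_stdGaussian (d : ℕ) :
    ∫ x : EuclideanSpace ℝ (Fin d), ‖x‖ ^ 2 ∂(stdGaussian _) = d := by
  rw [← map_pi_eq_stdGaussian, integral_map (by fun_prop) (by fun_prop)]
  simp only [EuclideanSpace.real_norm_sq_eq]
  rw [integral_finsetSum]
  · have h (i : Fin d) : ∫ u : Fin d → ℝ, u i ^ 2 ∂(Measure.pi fun _ => gaussianReal 0 1) = 1 := by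
      exact (integral_comp_eval (μ := fun _ : Fin d => gaussianReal 0 1) (i := i)
        (f := fun u : ℝ => u ^ 2) (by fun_prop)).trans integral_sq_gaussianReal
    simp [h]
  · intro i _
    exact integrable_comp_eval (μ := fun _ : Fin d => gaussianReal 0 1) (i := i)
      (f := fun u : ℝ => u ^ 2)
      (memLp_sq_gaussianReal.integrable (by norm_num))

lemma variance_norm_sq_stdGaussian (d : ℕ) :
    Var[fun x : EuclideanSpace ℝ (Fin d) => ‖x‖ ^ 2; stdGaussian _] = d * gaussianSqVar := by
  rw [← map_pi_eq_stdGaussian, variance_map (by fun_prop) (by fun_prop)]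
  have h : (fun x : EuclideanSpace ℝ (Fin d) => ‖x‖ ^ 2) ∘ WithLp.toLp 2 =
      ∑ i, fun u : Fin d → ℝ => (fun v : ℝ => v ^ 2) (u i) := by
    ext u
    simp [EuclideanSpace.real_norm_sq_eq]
  rw [h, variance_sum_pi fun _ => memLp_sq_gaussianReal]
  simp [gaussianSqVar]

lemma integral_abs_sub_mean_le_sqrt_variance {α : Type*} [MeasurableSpace α] {μ : Measure α}
    [IsProbabilityMeasure μ] {f : α → ℝ} (hf : MemLp f 2 μ) :
    ∫ a, |f a - ∫ b, f b ∂μ| ∂μ ≤ √(Var[f; μ]) := by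
  apply Real.le_sqrt_of_sq_le
  have h := hf.sub (memLp_const (∫ b, f b ∂μ))
  have h1 := variance_nonneg |f - fun _ => ∫ b, f b ∂μ| μ
  rw [variance_eq_sub h.abs] at h1
  rw [variance_eq_integral hf.1.aemeasurable]
  simpa using h1

/-- The squared norm of a standard Gaussian vector deviates from `d` by `O(√d)` in mean. -/
lemma integral_abs_norm_sq_sub_stdGaussian_le (d : ℕ) :
    ∫ x : EuclideanSpace ℝ (Fin d), |‖x‖ ^ 2 - d| ∂(stdGaussian _) ≤ √(d * gaussianSqVar) := by
  have h := integral_abs_sub_mean_le_sqrt_variance (memLp_norm_sq_stdGaussian d)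
  rwa [variance_norm_sq_stdGaussian, integral_norm_sq_stdGaussian] at h

/-! ### Mean deviations for a Gaussian state and a Gaussian noise -/

section Estimates

variable {Ω : Type*} [MeasurableSpace Ω] {P : Measure Ω} {d : ℕ}
  {X Z : Ω → EuclideanSpace ℝ (Fin d)}

lemma integrable_norm_sq_of_hasLaw (hX : HasLaw X (stdGaussian (EuclideanSpace ℝ (Fin d))) P) :
    Integrable (fun ω => ‖X ω‖ ^ 2) P := by
  have h := (memLp_norm_sq_stdGaussian d).integrable (by norm_num)
  rw [← hX.map_eq] at h
  exact h.comp_aemeasurable hX.aemeasurable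

lemma integral_norm_sq_of_hasLaw (hX : HasLaw X (stdGaussian (EuclideanSpace ℝ (Fin d))) P) :
    ∫ ω, ‖X ω‖ ^ 2 ∂P = d :=
  (hX.integral_comp (f := fun x => ‖x‖ ^ 2) (by fun_prop)).trans (integral_norm_sq_stdGaussian d)

lemma integral_abs_norm_sq_sub_le (hX : HasLaw X (stdGaussian (EuclideanSpace ℝ (Fin d))) P) :
    ∫ ω, |‖X ω‖ ^ 2 - d| ∂P ≤ √(d * gaussianSqVar) :=
  (hX.integral_comp (f := fun x => |‖x‖ ^ 2 - (d : ℝ)|) (by fun_prop)).trans_le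
    (integral_abs_norm_sq_sub_stdGaussian_le d)

lemma abs_real_inner_le_add_sq {E : Type*} [NormedAddCommGroup E] [InnerProductSpace ℝ E]
    (x z : E) : |inner ℝ x z| ≤ (‖x‖ ^ 2 + ‖z‖ ^ 2) / 2 := by
  linarith [abs_real_inner_le_norm x z, two_mul_le_add_sq ‖x‖ ‖z‖]

lemma integrable_inner_of_hasLaw (hX : HasLaw X (stdGaussian (EuclideanSpace ℝ (Fin d))) P)
    (hZ : HasLaw Z (stdGaussian (EuclideanSpace ℝ (Fin d))) P) :
    Integrable (fun ω => inner ℝ (X ω) (Z ω)) P := by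
  have := hX.aemeasurable
  have := hZ.aemeasurable
  exact (((integrable_norm_sq_of_hasLaw hX).add (integrable_norm_sq_of_hasLaw hZ)).div_const 2).mono'
    (by fun_prop) (ae_of_all _ fun ω => abs_real_inner_le_add_sq _ _)

lemma integral_abs_inner_le (hX : HasLaw X (stdGaussian (EuclideanSpace ℝ (Fin d))) P)
    (hZ : HasLaw Z (stdGaussian (EuclideanSpace ℝ (Fin d))) P) :
    ∫ ω, |inner ℝ (X ω) (Z ω)| ∂P ≤ d := by
  have iX := integrable_norm_sq_of_hasLaw hX
  have iZ := integrable_norm_sq_of_hasLaw hZ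
  calc ∫ ω, |inner ℝ (X ω) (Z ω)| ∂P ≤ ∫ ω, (‖X ω‖ ^ 2 + ‖Z ω‖ ^ 2) / 2 ∂P :=
        integral_mono (integrable_inner_of_hasLaw hX hZ).abs ((iX.add iZ).div_const 2)
          fun ω => abs_real_inner_le_add_sq _ _
    _ = d := by
        rw [integral_div, integral_add iX iZ, integral_norm_sq_of_hasLaw hX,
          integral_norm_sq_of_hasLaw hZ]
        ring

/-- Conditionally on `X`, the inner product `⟪X, Z⟫` is a centred Gaussian of variance `‖X‖²`. -/
lemma integral_cexp_inner [IsProbabilityMeasure P]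
    (hX : HasLaw X (stdGaussian (EuclideanSpace ℝ (Fin d))) P)
    (hZ : HasLaw Z (stdGaussian (EuclideanSpace ℝ (Fin d))) P) (hXZ : IndepFun X Z P) (s : ℝ) :
    ∫ ω, Complex.exp (Complex.I * (s * inner ℝ (X ω) (Z ω) : ℝ)) ∂P =
      ∫ ω, ((Real.exp (-(s ^ 2 * ‖X ω‖ ^ 2 / 2)) : ℝ) : ℂ) ∂P := by
  let f : EuclideanSpace ℝ (Fin d) × EuclideanSpace ℝ (Fin d) → ℂ :=
    fun q => Complex.exp (Complex.I * (s * inner ℝ q.1 q.2 : ℝ))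
  have hf : Continuous f := by fun_prop
  have hint : Integrable f ((stdGaussian _).prod (stdGaussian _)) :=
    (integrable_const (1 : ℝ)).mono' hf.aestronglyMeasurable
      (ae_of_all _ fun q => by simp only [f, Complex.norm_exp_I_mul_ofReal, le_refl])
  have hprod := (IndepFun.hasLaw_prod hX hZ hXZ).integral_comp (f := f) hf.aestronglyMeasurable
  refine hprod.trans ?_
  rw [integral_prod f hint]
  refine Eq.trans ?_ (hX.integral_comp
    (f := fun x => ((Real.exp (-(s ^ 2 * ‖x‖ ^ 2 / 2)) : ℝ) : ℂ)) (by fun_prop)).symm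
  refine integral_congr_ae (ae_of_all _ fun x => ?_)
  have h := charFun_stdGaussian (s • x)
  rw [charFun_apply] at h
  simp only [f]
  calc _ = ∫ z, Complex.exp ((inner ℝ z (s • x) : ℝ) * Complex.I) ∂(stdGaussian _) := by
        refine integral_congr_ae (ae_of_all _ fun z => ?_)
        simp only [inner_smul_right, real_inner_comm x z, mul_comm Complex.I]
    _ = _ := by
        rw [h, norm_smul]
        push_cast
        congr 1
        rw [mul_pow, ← Complex.ofReal_pow, Real.norm_eq_abs, sq_abs]
        push_cast
        ring

/-- Replacing the log-acceptance ratio by its mean plus its cross term costs `O(h² √d)` in mean. -/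
lemma integral_abs_logAcceptanceRatio_sub_le {h : ℝ} (hh : 0 ≤ h)
    (hX : HasLaw X (stdGaussian (EuclideanSpace ℝ (Fin d))) P)
    (hZ : HasLaw Z (stdGaussian (EuclideanSpace ℝ (Fin d))) P) :
    ∫ ω, |h / 8 * (‖X ω‖ ^ 2 - ‖ulaProposal (stdGaussianDensity d) h (X ω) (Z ω)‖ ^ 2) -
        (-(h ^ 3 * d / 32) + -(h / 4 * (1 - h / 2) * √h) * inner ℝ (X ω) (Z ω))| ∂P ≤
      (h ^ 2 / 4 + h ^ 3 / 32) * √(d * gaussianSqVar) := by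
  have := hX.isProbabilityMeasure
  have iX := ((integrable_norm_sq_of_hasLaw hX).sub (integrable_const (d : ℝ))).abs
  have iZ := ((integrable_norm_sq_of_hasLaw hZ).sub (integrable_const (d : ℝ))).abs
  simp only [Pi.sub_apply] at iX iZ
  calc _ ≤ ∫ ω, (h ^ 2 / 8 + h ^ 3 / 32) * |‖X ω‖ ^ 2 - d| + h ^ 2 / 8 * |‖Z ω‖ ^ 2 - d| ∂P := by
        refine integral_mono_of_nonneg (ae_of_all _ fun ω => abs_nonneg _)
          ((iX.const_mul _).add (iZ.const_mul _)) (ae_of_all _ fun ω => ?_)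
        have e : h / 8 * (‖X ω‖ ^ 2 - ‖ulaProposal (stdGaussianDensity d) h (X ω) (Z ω)‖ ^ 2) -
            (-(h ^ 3 * d / 32) + -(h / 4 * (1 - h / 2) * √h) * inner ℝ (X ω) (Z ω)) =
            (h ^ 2 / 8 - h ^ 3 / 32) * (‖X ω‖ ^ 2 - d) - h ^ 2 / 8 * (‖Z ω‖ ^ 2 - d) := by
          rw [norm_sq_ulaProposal hh]; ring
        simp only [e]
        refine (abs_sub _ _).trans ?_
        rw [abs_mul, abs_mul, abs_of_nonneg (show 0 ≤ h ^ 2 / 8 by positivity)]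
        gcongr
        exact (abs_sub _ _).trans (by
          rw [abs_of_nonneg (by positivity), abs_of_nonneg (by positivity)])
    _ = (h ^ 2 / 8 + h ^ 3 / 32) * ∫ ω, |‖X ω‖ ^ 2 - d| ∂P +
          h ^ 2 / 8 * ∫ ω, |‖Z ω‖ ^ 2 - d| ∂P := by
        rw [integral_add (iX.const_mul _) (iZ.const_mul _), integral_const_mul, integral_const_mul]
    _ ≤ (h ^ 2 / 8 + h ^ 3 / 32) * √(d * gaussianSqVar) + h ^ 2 / 8 * √(d * gaussianSqVar) := by
        gcongr
        · exact integral_abs_norm_sq_sub_le hX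
        · exact integral_abs_norm_sq_sub_le hZ
    _ = _ := by ring

lemma aemeasurable_ulaProposal (h : ℝ)
    (hX : HasLaw X (stdGaussian (EuclideanSpace ℝ (Fin d))) P)
    (hZ : HasLaw Z (stdGaussian (EuclideanSpace ℝ (Fin d))) P) :
    AEMeasurable (fun ω => ulaProposal (stdGaussianDensity d) h (X ω) (Z ω)) P := by
  simp only [ulaProposal_stdGaussianDensity]
  have := hX.aemeasurable
  have := hZ.aemeasurable
  fun_prop

lemma integrable_norm_sq_ulaProposal_sub {h : ℝ} (hh : 0 ≤ h)
    (hX : HasLaw X (stdGaussian (EuclideanSpace ℝ (Fin d))) P)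
    (hZ : HasLaw Z (stdGaussian (EuclideanSpace ℝ (Fin d))) P) :
    Integrable (fun ω => ‖X ω - ulaProposal (stdGaussianDensity d) h (X ω) (Z ω)‖ ^ 2) P := by
  simp only [norm_sq_ulaProposal_sub hh]
  exact (((integrable_norm_sq_of_hasLaw hX).const_mul _).sub
    ((integrable_inner_of_hasLaw hX hZ).const_mul _)).add
      ((integrable_norm_sq_of_hasLaw hZ).const_mul _)

/-- The squared proposal distance is `h d`, up to an error of smaller order in mean. -/
lemma integral_abs_norm_sq_ulaProposal_sub_le {h : ℝ} (hh : 0 ≤ h)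
    (hX : HasLaw X (stdGaussian (EuclideanSpace ℝ (Fin d))) P)
    (hZ : HasLaw Z (stdGaussian (EuclideanSpace ℝ (Fin d))) P) :
    ∫ ω, |‖X ω - ulaProposal (stdGaussianDensity d) h (X ω) (Z ω)‖ ^ 2 - h * d| ∂P ≤
      h ^ 2 / 4 * d + h * √h * d + h * √(d * gaussianSqVar) := by
  have := hX.isProbabilityMeasure
  have iX := integrable_norm_sq_of_hasLaw hX
  have iZ := ((integrable_norm_sq_of_hasLaw hZ).sub (integrable_const (d : ℝ))).abs
  have iI := (integrable_inner_of_hasLaw hX hZ).abs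
  simp only [Pi.sub_apply] at iZ
  calc _ ≤ ∫ ω, h ^ 2 / 4 * ‖X ω‖ ^ 2 + h * √h * |inner ℝ (X ω) (Z ω)| +
            h * |‖Z ω‖ ^ 2 - d| ∂P := by
        refine integral_mono_of_nonneg (ae_of_all _ fun ω => abs_nonneg _)
          (((iX.const_mul _).add (iI.const_mul _)).add (iZ.const_mul _))
          (ae_of_all _ fun ω => ?_)
        simp only [norm_sq_ulaProposal_sub hh]
        have e : h ^ 2 / 4 * ‖X ω‖ ^ 2 - h * √h * inner ℝ (X ω) (Z ω) + h * ‖Z ω‖ ^ 2 - h * d =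
            h ^ 2 / 4 * ‖X ω‖ ^ 2 - h * √h * inner ℝ (X ω) (Z ω) + h * (‖Z ω‖ ^ 2 - d) := by ring
        rw [e]
        refine (abs_add_le _ _).trans ?_
        refine add_le_add ((abs_sub _ _).trans ?_) ?_
        · rw [abs_mul (h * √h), abs_of_nonneg (show 0 ≤ h * √h by positivity),
            abs_of_nonneg (show 0 ≤ h ^ 2 / 4 * ‖X ω‖ ^ 2 by positivity)]
        · rw [abs_mul, abs_of_nonneg hh]
    _ = h ^ 2 / 4 * ∫ ω, ‖X ω‖ ^ 2 ∂P + h * √h * ∫ ω, |inner ℝ (X ω) (Z ω)| ∂P +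
          h * ∫ ω, |‖Z ω‖ ^ 2 - d| ∂P := by
        have iXI : Integrable (fun ω => h ^ 2 / 4 * ‖X ω‖ ^ 2 +
            h * √h * |inner ℝ (X ω) (Z ω)|) P := (iX.const_mul _).add (iI.const_mul _)
        rw [integral_add iXI (iZ.const_mul _), integral_add (iX.const_mul _) (iI.const_mul _),
          integral_const_mul, integral_const_mul, integral_const_mul]
    _ ≤ _ := by
        rw [integral_norm_sq_of_hasLaw hX]
        gcongr
        · exact integral_abs_inner_le hX hZ
        · exact integral_abs_norm_sq_sub_le hZ

end Estimates

/-! ### The characteristic function of the log-ratio -/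

lemma norm_cexp_I_mul_ofReal_sub_le (a b : ℝ) :
    ‖Complex.exp (Complex.I * a) - Complex.exp (Complex.I * b)‖ ≤ |a - b| := by
  have e : Complex.exp (Complex.I * a) - Complex.exp (Complex.I * b) =
      Complex.exp (Complex.I * b) * (Complex.exp (Complex.I * (a - b : ℝ)) - 1) := by
    rw [mul_sub, ← Complex.exp_add, mul_one]
    congr 2
    push_cast
    ring
  rw [e, norm_mul, Complex.norm_exp_I_mul_ofReal, one_mul]
  exact Real.norm_exp_I_mul_ofReal_sub_one_le

lemma abs_exp_neg_sub_exp_neg_le {a b : ℝ} (ha : 0 ≤ a) (hb : 0 ≤ b) :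
    |Real.exp (-a) - Real.exp (-b)| ≤ |a - b| := by
  wlog hab : a ≤ b generalizing a b
  · rw [abs_sub_comm, abs_sub_comm a]
    exact this hb ha (le_of_not_ge hab)
  rw [abs_of_nonneg (sub_nonneg.2 (Real.exp_le_exp.2 (neg_le_neg hab))), abs_sub_comm,
    abs_of_nonneg (sub_nonneg.2 hab)]
  have h1 : Real.exp (-b) = Real.exp (-a) * Real.exp (-(b - a)) := by
    rw [← Real.exp_add]; congr 1; ring
  have h2 := Real.add_one_le_exp (-(b - a))
  have h3 : Real.exp (-a) ≤ 1 := Real.exp_le_one_iff.2 (by linarith)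
  rw [h1]
  nlinarith [Real.exp_pos (-a)]

/-- A non-asymptotic Gaussian approximation of the characteristic function of the log-ratio: the
first error term comes from dropping the lower-order terms, the second one from replacing the
conditional variance of the cross term, proportional to `‖X‖²`, by its mean. -/
lemma norm_charFun_logAcceptanceRatio_sub_le {Ω : Type*} [MeasurableSpace Ω] {P : Measure Ω}
    [IsProbabilityMeasure P] {d : ℕ} {X Z : Ω → EuclideanSpace ℝ (Fin d)} {h : ℝ} (hh : 0 ≤ h)
    (hX : HasLaw X (stdGaussian (EuclideanSpace ℝ (Fin d))) P)
    (hZ : HasLaw Z (stdGaussian (EuclideanSpace ℝ (Fin d))) P) (hXZ : IndepFun X Z P) (t : ℝ) :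
    ‖∫ ω, Complex.exp (Complex.I * (t * (h / 8 * (‖X ω‖ ^ 2 -
          ‖ulaProposal (stdGaussianDensity d) h (X ω) (Z ω)‖ ^ 2)) : ℝ)) ∂P -
        Complex.exp (Complex.I * (t * -(h ^ 3 * d / 32) : ℝ)) *
          (Real.exp (-(t ^ 2 * (h ^ 3 * d * (1 - h / 2) ^ 2 / 32))) : ℝ)‖ ≤
      |t| * ((h ^ 2 / 4 + h ^ 3 / 32) * √(d * gaussianSqVar)) +
        t ^ 2 * (h ^ 3 * (1 - h / 2) ^ 2 / 32) * √(d * gaussianSqVar) := by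
  have mX := hX.aemeasurable
  have mZ := hZ.aemeasurable
  have mY := aemeasurable_ulaProposal h hX hZ
  set c : ℝ := -(h / 4 * (1 - h / 2) * √h) with hc
  have hc2 : c ^ 2 = h ^ 3 * (1 - h / 2) ^ 2 / 16 := by
    rw [hc, neg_sq, mul_pow, Real.sq_sqrt hh]; ring
  set W : Ω → ℝ := fun ω =>
    h / 8 * (‖X ω‖ ^ 2 - ‖ulaProposal (stdGaussianDensity d) h (X ω) (Z ω)‖ ^ 2)
  set Y : Ω → ℝ := fun ω => -(h ^ 3 * d / 32) + c * inner ℝ (X ω) (Z ω)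
  have mW : AEMeasurable W P := by fun_prop
  have mY' : AEMeasurable Y P := by fun_prop
  have hint (V : Ω → ℝ) (hV : AEMeasurable V P) :
      Integrable (fun ω => Complex.exp (Complex.I * (t * V ω : ℝ))) P :=
    (integrable_const (1 : ℝ)).mono' (by fun_prop)
      (ae_of_all _ fun ω => by rw [Complex.norm_exp_I_mul_ofReal])
  have iX := integrable_norm_sq_of_hasLaw hX
  have iWY : Integrable (fun ω => |W ω - Y ω|) P := by
    have e : (fun ω => W ω - Y ω) = fun ω => (h ^ 2 / 8 - h ^ 3 / 32) * (‖X ω‖ ^ 2 - d) -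
        h ^ 2 / 8 * (‖Z ω‖ ^ 2 - d) := by
      funext ω
      simp only [W, Y, c, norm_sq_ulaProposal hh]
      ring
    have i : Integrable (fun ω => W ω - Y ω) P := by
      rw [e]
      exact ((iX.sub (integrable_const _)).const_mul _).sub
        (((integrable_norm_sq_of_hasLaw hZ).sub (integrable_const _)).const_mul _)
    exact i.abs
  have h1 : ‖∫ ω, Complex.exp (Complex.I * (t * W ω : ℝ)) ∂P -
      ∫ ω, Complex.exp (Complex.I * (t * Y ω : ℝ)) ∂P‖ ≤
      |t| * ((h ^ 2 / 4 + h ^ 3 / 32) * √(d * gaussianSqVar)) := by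
    rw [← integral_sub (hint W mW) (hint Y mY')]
    calc _ ≤ ∫ ω, |t| * |W ω - Y ω| ∂P := by
          refine norm_integral_le_of_norm_le (iWY.const_mul _) (ae_of_all _ fun ω => ?_)
          refine (norm_cexp_I_mul_ofReal_sub_le _ _).trans_eq ?_
          rw [← abs_mul, mul_sub]
      _ ≤ _ := by
          rw [integral_const_mul]
          gcongr
          exact integral_abs_logAcceptanceRatio_sub_le hh hX hZ
  have h2 : ∫ ω, Complex.exp (Complex.I * (t * Y ω : ℝ)) ∂P =
      Complex.exp (Complex.I * (t * -(h ^ 3 * d / 32) : ℝ)) *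
        ((∫ ω, Real.exp (-((t * c) ^ 2 * ‖X ω‖ ^ 2 / 2)) ∂P : ℝ) : ℂ) := by
    rw [← integral_complex_ofReal, ← integral_cexp_inner hX hZ hXZ, ← integral_const_mul]
    refine integral_congr_ae (ae_of_all _ fun ω => ?_)
    simp only [Y]
    rw [← Complex.exp_add]
    congr 1
    push_cast
    ring
  have h3 : |∫ ω, Real.exp (-((t * c) ^ 2 * ‖X ω‖ ^ 2 / 2)) ∂P -
      Real.exp (-(t ^ 2 * (h ^ 3 * d * (1 - h / 2) ^ 2 / 32)))| ≤
        t ^ 2 * (h ^ 3 * (1 - h / 2) ^ 2 / 32) * √(d * gaussianSqVar) := by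
    have iE : Integrable (fun ω => Real.exp (-((t * c) ^ 2 * ‖X ω‖ ^ 2 / 2))) P :=
      (integrable_const (1 : ℝ)).mono' (by fun_prop) (ae_of_all _ fun ω => by
        rw [Real.norm_eq_abs, Real.abs_exp]
        exact Real.exp_le_one_iff.2 (neg_nonpos.2 (by positivity)))
    have e : Real.exp (-(t ^ 2 * (h ^ 3 * d * (1 - h / 2) ^ 2 / 32))) =
        ∫ _, Real.exp (-((t * c) ^ 2 * d / 2)) ∂P := by
      rw [integral_const, probReal_univ, one_smul, mul_pow, hc2]
      congr 1
      ring
    rw [e, ← integral_sub iE (integrable_const _), ← Real.norm_eq_abs]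
    calc _ ≤ ∫ ω, (t * c) ^ 2 / 2 * |‖X ω‖ ^ 2 - d| ∂P := by
          refine norm_integral_le_of_norm_le
            ((iX.sub (integrable_const (d : ℝ))).abs.const_mul _) (ae_of_all _ fun ω => ?_)
          refine (abs_exp_neg_sub_exp_neg_le (by positivity) (by positivity)).trans_eq ?_
          rw [← abs_of_nonneg (show 0 ≤ (t * c) ^ 2 / 2 by positivity), ← abs_mul]
          congr 1
          ring
      _ = t ^ 2 * (h ^ 3 * (1 - h / 2) ^ 2 / 32) * ∫ ω, |‖X ω‖ ^ 2 - d| ∂P := by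
          rw [integral_const_mul, mul_pow, hc2]
          ring
      _ ≤ _ := by
          gcongr
          exact integral_abs_norm_sq_sub_le hX
  refine (norm_sub_le_norm_sub_add_norm_sub _
    (∫ ω, Complex.exp (Complex.I * (t * Y ω : ℝ)) ∂P) _).trans (add_le_add h1 ?_)
  rw [h2, ← mul_sub, norm_mul, Complex.norm_exp_I_mul_ofReal, one_mul, ← Complex.ofReal_sub,
    Complex.norm_real, Real.norm_eq_abs]
  exact h3

/-! ### Integrating out the acceptance variable -/

lemma barkerFun_nonneg (w : ℝ) : 0 ≤ barkerFun w := by unfold barkerFun; positivity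

lemma barkerFun_le_one (w : ℝ) : barkerFun w ≤ 1 := by
  unfold barkerFun
  exact div_le_one_of_le₀ (by linarith [Real.exp_pos (-w)]) (by positivity)

lemma abs_barkerFun_le_one (w : ℝ) : |barkerFun w| ≤ 1 :=
  (abs_of_nonneg (barkerFun_nonneg w)).trans_le (barkerFun_le_one w)

@[fun_prop]
lemma continuous_barkerFun : Continuous barkerFun := by
  unfold barkerFun
  exact continuous_const.div (by fun_prop) fun w => by positivity

/-- An independent uniform variable turns the acceptance event into its probability. -/
lemma integral_ite_le_uniform {Ω 𝓣 : Type*} [MeasurableSpace Ω] [MeasurableSpace 𝓣]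
    {P : Measure Ω} [IsProbabilityMeasure P] {ν : Measure 𝓣} [IsProbabilityMeasure ν]
    {T : Ω → 𝓣} {U : Ω → ℝ} (hT : HasLaw T ν P)
    (hU : HasLaw U (volume.restrict (Set.Icc (0 : ℝ) 1)) P) (hTU : IndepFun T U P)
    {α D : 𝓣 → ℝ} (hα : Measurable α) (hα0 : ∀ q, 0 ≤ α q) (hα1 : ∀ q, α q ≤ 1)
    (hD : Measurable D) (hDint : Integrable D ν) :
    ∫ ω, (if U ω ≤ α (T ω) then D (T ω) else 0) ∂P = ∫ ω, D (T ω) * α (T ω) ∂P := by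
  let F : 𝓣 × ℝ → ℝ := fun r => if r.2 ≤ α r.1 then D r.1 else 0
  have hF : Measurable F :=
    Measurable.ite (measurableSet_le (by fun_prop) (by fun_prop)) (by fun_prop) measurable_const
  have hFint : Integrable F (ν.prod (volume.restrict (Set.Icc (0 : ℝ) 1))) := by
    refine (hDint.comp_fst _).norm.mono' hF.aestronglyMeasurable (ae_of_all _ fun r => ?_)
    simp only [F]
    split_ifs <;> simp
  refine ((IndepFun.hasLaw_prod hT hU hTU).integral_comp (f := F)
    hF.aestronglyMeasurable).trans ?_
  rw [integral_prod F hFint]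
  refine Eq.trans ?_ (hT.integral_comp (f := fun q => D q * α q) (by fun_prop)).symm
  refine integral_congr_ae (ae_of_all _ fun q => ?_)
  have hset : Set.Icc (0 : ℝ) 1 ∩ Set.Iic (α q) = Set.Icc 0 (α q) := by
    ext u
    simp only [Set.mem_inter_iff, Set.mem_Icc, Set.mem_Iic]
    exact ⟨fun h => ⟨h.1.1, h.2⟩, fun h => ⟨⟨h.1, h.2.trans (hα1 q)⟩, h.2⟩⟩
  have hind : (fun u => F (q, u)) = (Set.Iic (α q)).indicator fun _ => D q := by
    funext u
    simp [F, Set.indicator_apply]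
  simp only [hind]
  rw [integral_indicator measurableSet_Iic, Measure.restrict_restrict measurableSet_Iic,
    Set.inter_comm, hset, setIntegral_const, Measure.real, Real.volume_Icc, sub_zero,
    ENNReal.toReal_ofReal (hα0 q), smul_eq_mul, mul_comm]

lemma expectedSqJump_barkerStep {Ω : Type*} [MeasurableSpace Ω] {P : Measure Ω}
    [IsProbabilityMeasure P] {d : ℕ} {X Z : Ω → EuclideanSpace ℝ (Fin d)} {U : Ω → ℝ}
    {ℓ : ℝ} (hℓ : 0 < ℓ)
    (hX : HasLaw X (stdGaussian (EuclideanSpace ℝ (Fin d))) P)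
    (hZ : HasLaw Z (stdGaussian (EuclideanSpace ℝ (Fin d))) P)
    (hU : HasLaw U (volume.restrict (Set.Icc (0 : ℝ) 1)) P)
    (hXZ : IndepFun X Z P) (hXZU : IndepFun (fun ω => (X ω, Z ω)) U P) :
    expectedSqJump P X
        (fun ω => barkerStep (stdGaussianDensity d) (stepSize ℓ d) (X ω) (Z ω) (U ω)) =
      ∫ ω, ‖X ω - ulaProposal (stdGaussianDensity d) (stepSize ℓ d) (X ω) (Z ω)‖ ^ 2 *
        barkerAcceptance (stdGaussianDensity d) (stepSize ℓ d) (X ω)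
          (ulaProposal (stdGaussianDensity d) (stepSize ℓ d) (X ω) (Z ω)) ∂P := by
  have hh := stepSize_nonneg ℓ d
  have hprod := IndepFun.hasLaw_prod hX hZ hXZ
  have hprop : Measurable fun q : EuclideanSpace ℝ (Fin d) × EuclideanSpace ℝ (Fin d) =>
      ulaProposal (stdGaussianDensity d) (stepSize ℓ d) q.1 q.2 := by
    simp only [ulaProposal_stdGaussianDensity]
    fun_prop
  have hD : Measurable fun q : EuclideanSpace ℝ (Fin d) × EuclideanSpace ℝ (Fin d) =>
      ‖q.1 - ulaProposal (stdGaussianDensity d) (stepSize ℓ d) q.1 q.2‖ ^ 2 := by fun_prop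
  have hDint : Integrable (fun q : EuclideanSpace ℝ (Fin d) × EuclideanSpace ℝ (Fin d) =>
      ‖q.1 - ulaProposal (stdGaussianDensity d) (stepSize ℓ d) q.1 q.2‖ ^ 2)
      ((stdGaussian _).prod (stdGaussian _)) := by
    rw [← hprod.map_eq, integrable_map_measure hD.aestronglyMeasurable hprod.aemeasurable]
    exact integrable_norm_sq_ulaProposal_sub hh hX hZ
  have hα : Measurable fun q : EuclideanSpace ℝ (Fin d) × EuclideanSpace ℝ (Fin d) =>
      barkerAcceptance (stdGaussianDensity d) (stepSize ℓ d) q.1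
        (ulaProposal (stdGaussianDensity d) (stepSize ℓ d) q.1 q.2) := by
    simp only [barkerAcceptance, logAcceptanceRatio_stepSize hℓ]
    exact continuous_barkerFun.measurable.comp (by fun_prop)
  refine Eq.trans ?_ (integral_ite_le_uniform hprod hU hXZU hα (fun q => barkerFun_nonneg _)
    (fun q => barkerFun_le_one _) hD hDint)
  refine integral_congr_ae (ae_of_all _ fun ω => ?_)
  simp only [barkerStep]
  split_ifs
  · rw [norm_sub_rev]
  · simp

/-! ### Limits along the step sizes -/

lemma tendsto_stepSize (ℓ : ℝ) : Tendsto (stepSize ℓ) atTop (𝓝 0) := by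
  have h := ((tendsto_rpow_neg_atTop (show (0 : ℝ) < 1 / 3 by norm_num)).comp
    tendsto_natCast_atTop_atTop).const_mul (ℓ ^ 2)
  rwa [mul_zero] at h

lemma stepSize_pow_three_mul (ℓ : ℝ) {d : ℕ} (hd : 0 < d) : stepSize ℓ d ^ 3 * d = ℓ ^ 6 := by
  have hd' : (0 : ℝ) < d := by exact_mod_cast hd
  rw [stepSize, mul_pow, ← Real.rpow_natCast, ← Real.rpow_natCast ((d : ℝ) ^ _),
    ← Real.rpow_mul hd'.le, mul_assoc, ← Real.rpow_add_one hd'.ne']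
  norm_num
  ring

lemma rpow_neg_two_thirds_eq {ℓ : ℝ} (hℓ : 0 < ℓ) (d : ℕ) :
    (d : ℝ) ^ (-(2 / 3) : ℝ) = stepSize ℓ d ^ 2 / ℓ ^ 4 := by
  rw [stepSize, mul_pow, ← Real.rpow_natCast ((d : ℝ) ^ _), ← Real.rpow_mul (Nat.cast_nonneg d)]
  norm_num
  field_simp

/-- `h_d² √d → 0`, since `(h_d² √d)² = ℓ⁶ h_d`. -/
lemma tendsto_stepSize_sq_mul_sqrt (ℓ K : ℝ) :
    Tendsto (fun d : ℕ => stepSize ℓ d ^ 2 * √(d * K)) atTop (𝓝 0) := by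
  have h : Tendsto (fun d : ℕ => √(ℓ ^ 6 * stepSize ℓ d) * √K) atTop (𝓝 0) := by
    simpa using ((tendsto_stepSize ℓ).const_mul (ℓ ^ 6)).sqrt.mul_const √K
  refine h.congr' ?_
  filter_upwards [eventually_gt_atTop 0] with d hd
  have e : ℓ ^ 6 * stepSize ℓ d = (stepSize ℓ d ^ 2) ^ 2 * d := by
    rw [← stepSize_pow_three_mul ℓ hd]; ring
  rw [e, Real.sqrt_mul (by positivity), Real.sqrt_sq (by positivity),
    Real.sqrt_mul (Nat.cast_nonneg d), mul_assoc]

section Limits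

variable {ℓ : ℝ} {Ω : ℕ → Type*} [∀ d, MeasurableSpace (Ω d)]
  {P : ∀ d, Measure (Ω d)} [∀ d, IsProbabilityMeasure (P d)]
  {X Z : ∀ d, Ω d → EuclideanSpace ℝ (Fin d)}

/-- By Lévy's continuity theorem, the bound on the characteristic functions gives convergence in
distribution: with `h_d³ d = ℓ⁶`, the approximating Gaussian characteristic function converges and
both error terms vanish. -/
lemma tendstoInDistribution_logAcceptanceRatio (hℓ : 0 < ℓ)
    (hX : ∀ d, HasLaw (X d) (stdGaussian (EuclideanSpace ℝ (Fin d))) (P d))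
    (hZ : ∀ d, HasLaw (Z d) (stdGaussian (EuclideanSpace ℝ (Fin d))) (P d))
    (hXZ : ∀ d, IndepFun (X d) (Z d) (P d)) :
    TendstoInDistribution
      (fun d ω => logAcceptanceRatio (stdGaussianDensity d) (stepSize ℓ d) (X d ω)
        (ulaProposal (stdGaussianDensity d) (stepSize ℓ d) (X d ω) (Z d ω)))
      atTop (id : ℝ → ℝ) P (gaussianReal (-ℓ ^ 6 / 32) (ℓ ^ 6 / 16).toNNReal) := by
  simp only [logAcceptanceRatio_stepSize hℓ]
  have mW (d : ℕ) : AEMeasurable (fun ω => stepSize ℓ d / 8 * (‖X d ω‖ ^ 2 -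
      ‖ulaProposal (stdGaussianDensity d) (stepSize ℓ d) (X d ω) (Z d ω)‖ ^ 2)) (P d) := by
    have := (hX d).aemeasurable
    have := aemeasurable_ulaProposal (stepSize ℓ d) (hX d) (hZ d)
    fun_prop
  refine ⟨mW, aemeasurable_id, ?_⟩
  refine ProbabilityMeasure.tendsto_iff_tendsto_charFun.2 fun t => ?_
  simp only [ProbabilityMeasure.coe_mk, Measure.map_id]
  have hmap (d : ℕ) := integral_map (mW d) (f := fun w : ℝ => Complex.exp (t * w * Complex.I))
    (by fun_prop)
  simp only [charFun_apply_real t, hmap]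
  rw [← charFun_apply_real t, charFun_gaussianReal, Real.coe_toNNReal _ (by positivity)]
  have hstep := tendsto_stepSize ℓ
  have hsq := tendsto_stepSize_sq_mul_sqrt ℓ gaussianSqVar
  have hmain : Tendsto (fun d : ℕ => Complex.exp (Complex.I *
      (t * -(stepSize ℓ d ^ 3 * d / 32) : ℝ)) *
        (Real.exp (-(t ^ 2 * (stepSize ℓ d ^ 3 * d * (1 - stepSize ℓ d / 2) ^ 2 / 32))) : ℝ))
      atTop (𝓝 (Complex.exp (Complex.I * (t * -(ℓ ^ 6 / 32) : ℝ)) *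
        (Real.exp (-(t ^ 2 * (ℓ ^ 6 * (1 - 0 / 2) ^ 2 / 32))) : ℝ))) := by
    have hcont : Continuous fun h : ℝ => Complex.exp (Complex.I * (t * -(ℓ ^ 6 / 32) : ℝ)) *
        (Real.exp (-(t ^ 2 * (ℓ ^ 6 * (1 - h / 2) ^ 2 / 32))) : ℝ) := by fun_prop
    refine ((hcont.tendsto 0).comp hstep).congr' ?_
    filter_upwards [eventually_gt_atTop 0] with d hd
    simp only [Function.comp_apply, stepSize_pow_three_mul ℓ hd]
  have hlim : Complex.exp (Complex.I * (t * -(ℓ ^ 6 / 32) : ℝ)) *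
        (Real.exp (-(t ^ 2 * (ℓ ^ 6 * (1 - 0 / 2) ^ 2 / 32))) : ℝ) =
      Complex.exp (t * ((-ℓ ^ 6 / 32 : ℝ) : ℂ) * Complex.I - ((ℓ ^ 6 / 16 : ℝ) : ℂ) * t ^ 2 / 2) := by
    rw [Complex.ofReal_exp, ← Complex.exp_add]
    congr 1
    push_cast
    ring
  rw [← hlim]
  have herr : Tendsto (fun d : ℕ =>
      |t| * ((stepSize ℓ d ^ 2 / 4 + stepSize ℓ d ^ 3 / 32) * √(d * gaussianSqVar)) +
        t ^ 2 * (stepSize ℓ d ^ 3 * (1 - stepSize ℓ d / 2) ^ 2 / 32) * √(d * gaussianSqVar))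
      atTop (𝓝 0) := by
    have hcont : Continuous fun r : ℝ × ℝ =>
      (|t| * (1 / 4 + r.1 / 32) + t ^ 2 * (r.1 * (1 - r.1 / 2) ^ 2 / 32)) * r.2 := by fun_prop
    have h := (hcont.tendsto (0, 0)).comp (hstep.prodMk_nhds hsq)
    simp only [mul_zero] at h
    refine h.congr fun d => ?_
    simp only [Function.comp_apply]
    ring
  refine (tendsto_iff_of_dist ?_).1 hmain
  refine squeeze_zero (fun d => dist_nonneg) (fun d => ?_) herr
  rw [dist_comm, dist_eq_norm]
  refine le_trans (le_of_eq ?_) (norm_charFun_logAcceptanceRatio_sub_le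
    (stepSize_nonneg ℓ d) (hX d) (hZ d) (hXZ d) t)
  congr 3
  funext ω
  congr 1
  push_cast
  ring

lemma tendsto_integral_barkerAcceptance (hℓ : 0 < ℓ)
    (hX : ∀ d, HasLaw (X d) (stdGaussian (EuclideanSpace ℝ (Fin d))) (P d))
    (hZ : ∀ d, HasLaw (Z d) (stdGaussian (EuclideanSpace ℝ (Fin d))) (P d))
    (hXZ : ∀ d, IndepFun (X d) (Z d) (P d)) :
    Tendsto (fun d => ∫ ω, barkerAcceptance (stdGaussianDensity d) (stepSize ℓ d) (X d ω)
        (ulaProposal (stdGaussianDensity d) (stepSize ℓ d) (X d ω) (Z d ω)) ∂(P d))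
      atTop (𝓝 (limitAcceptance ℓ)) := by
  have hW := tendstoInDistribution_logAcceptanceRatio hℓ hX hZ hXZ
  let g : BoundedContinuousFunction ℝ ℝ := BoundedContinuousFunction.ofNormedAddCommGroup barkerFun
    continuous_barkerFun 1 abs_barkerFun_le_one
  have h := ProbabilityMeasure.tendsto_iff_forall_integral_tendsto.1 hW.tendsto g
  have hlim : limitAcceptance ℓ =
      ∫ w, barkerFun w ∂(gaussianReal (-ℓ ^ 6 / 32) (ℓ ^ 6 / 16).toNNReal) := by
    rw [limitAcceptance]
    congr 2
    ring
  rw [hlim]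
  simp only [ProbabilityMeasure.coe_mk, Measure.map_id] at h
  refine h.congr fun d => ?_
  exact integral_map (hW.forall_aemeasurable d) (by fun_prop)

/-- The rescaled squared proposal distance converges to `ℓ²` in mean, so the bounded acceptance
probability multiplying it may be averaged separately. -/
lemma tendsto_rpow_mul_integral_norm_sq_mul_barkerAcceptance (hℓ : 0 < ℓ)
    (hX : ∀ d, HasLaw (X d) (stdGaussian (EuclideanSpace ℝ (Fin d))) (P d))
    (hZ : ∀ d, HasLaw (Z d) (stdGaussian (EuclideanSpace ℝ (Fin d))) (P d))
    (hXZ : ∀ d, IndepFun (X d) (Z d) (P d)) :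
    Tendsto (fun d : ℕ => (d : ℝ) ^ (-(2 / 3) : ℝ) *
      ∫ ω, ‖X d ω - ulaProposal (stdGaussianDensity d) (stepSize ℓ d) (X d ω) (Z d ω)‖ ^ 2 *
        barkerAcceptance (stdGaussianDensity d) (stepSize ℓ d) (X d ω)
          (ulaProposal (stdGaussianDensity d) (stepSize ℓ d) (X d ω) (Z d ω)) ∂(P d))
      atTop (𝓝 (ℓ ^ 2 * limitAcceptance ℓ)) := by
  have hstep := tendsto_stepSize ℓ
  have hsq := tendsto_stepSize_sq_mul_sqrt ℓ gaussianSqVar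
  have hmain := (tendsto_integral_barkerAcceptance hℓ hX hZ hXZ).const_mul (ℓ ^ 2)
  have herr : Tendsto (fun d : ℕ => ℓ ^ 2 * stepSize ℓ d / 4 + ℓ ^ 2 * √(stepSize ℓ d) +
      stepSize ℓ d * (stepSize ℓ d ^ 2 * √(d * gaussianSqVar)) / ℓ ^ 4) atTop (𝓝 0) := by
    simpa using (((hstep.const_mul (ℓ ^ 2)).div_const 4).add (hstep.sqrt.const_mul (ℓ ^ 2))).add
      ((hstep.mul hsq).div_const (ℓ ^ 4))
  refine (tendsto_iff_of_dist ?_).1 hmain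
  refine squeeze_zero' (Eventually.of_forall fun d => dist_nonneg) ?_ herr
  filter_upwards [eventually_gt_atTop 0] with d hd
  have hh := stepSize_nonneg ℓ d
  have hW := (tendstoInDistribution_logAcceptanceRatio hℓ hX hZ hXZ).forall_aemeasurable d
  have h3 := stepSize_pow_three_mul ℓ hd
  rw [rpow_neg_two_thirds_eq hℓ]
  set h := stepSize ℓ d
  set D : Ω d → ℝ := fun ω => ‖X d ω - ulaProposal (stdGaussianDensity d) h (X d ω) (Z d ω)‖ ^ 2
  set α : Ω d → ℝ := fun ω => barkerAcceptance (stdGaussianDensity d) h (X d ω)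
    (ulaProposal (stdGaussianDensity d) h (X d ω) (Z d ω))
  have iD : Integrable D (P d) := integrable_norm_sq_ulaProposal_sub hh (hX d) (hZ d)
  have mα : AEMeasurable α (P d) := continuous_barkerFun.measurable.comp_aemeasurable hW
  have hα (ω : Ω d) : |α ω| ≤ 1 := abs_barkerFun_le_one _
  have iα : Integrable α (P d) :=
    (integrable_const (1 : ℝ)).mono' mα.aestronglyMeasurable (ae_of_all _ hα)
  have iDα : Integrable (fun ω => D ω * α ω) (P d) :=
    iD.mul_bdd (c := 1) mα.aestronglyMeasurable (ae_of_all _ hα)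
  -- The prefactor `h² / ℓ⁴` is `d^{-2/3}`; since `h³ d = ℓ⁶`, it rescales `h d` to exactly `ℓ²`.
  have e : h ^ 2 / ℓ ^ 4 * ∫ ω, D ω * α ω ∂(P d) - ℓ ^ 2 * ∫ ω, α ω ∂(P d) =
      h ^ 2 / ℓ ^ 4 * ∫ ω, (D ω - h * d) * α ω ∂(P d) := by
    have e1 : ∫ ω, (D ω - h * d) * α ω ∂(P d) =
        ∫ ω, D ω * α ω ∂(P d) - h * d * ∫ ω, α ω ∂(P d) := by
      rw [← integral_const_mul, ← integral_sub iDα (iα.const_mul _)]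
      simp only [sub_mul]
    have e2 : ℓ ^ 2 = h ^ 2 / ℓ ^ 4 * (h * d) := by
      field_simp
      linarith
    rw [e1, mul_sub, ← mul_assoc _ (h * d), ← e2]
  rw [dist_comm, Real.dist_eq, e, abs_mul, abs_of_nonneg (by positivity)]
  calc _ ≤ h ^ 2 / ℓ ^ 4 * (h ^ 2 / 4 * d + h * √h * d + h * √(d * gaussianSqVar)) := by
        gcongr
        refine le_trans ?_ (integral_abs_norm_sq_ulaProposal_sub_le hh (hX d) (hZ d))
        rw [← Real.norm_eq_abs]
        refine norm_integral_le_of_norm_le (iD.sub (integrable_const _)).abs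
          (ae_of_all _ fun ω => ?_)
        rw [norm_mul]
        exact mul_le_of_le_one_right (abs_nonneg _) (hα ω)
    _ = h ^ 3 * d / ℓ ^ 4 * (h / 4 + √h) + h * (h ^ 2 * √(d * gaussianSqVar)) / ℓ ^ 4 := by ring
    _ = _ := by
        rw [h3]
        field_simp

end Limits

/-! ### Scaling limit of the Barker-adjusted Langevin chain -/

theorem mainTheorem6 (ℓ : ℝ) (hℓ : 0 < ℓ)
    {Ω : ℕ → Type*} [∀ d, MeasurableSpace (Ω d)]
    (P : ∀ d, Measure (Ω d)) [∀ d, IsProbabilityMeasure (P d)]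
    (X Z : ∀ d, Ω d → EuclideanSpace ℝ (Fin d)) (U : ∀ d, Ω d → ℝ)
    -- the current state is stationary, the noise is standard Gaussian, `U` is uniform on `[0, 1]`
    (hX : ∀ d, HasLaw (X d) (stdGaussian (EuclideanSpace ℝ (Fin d))) (P d))
    (hZ : ∀ d, HasLaw (Z d) (stdGaussian (EuclideanSpace ℝ (Fin d))) (P d))
    (hU : ∀ d, HasLaw (U d) (volume.restrict (Set.Icc (0 : ℝ) 1)) (P d))
    -- `X d`, `Z d`, `U d` are independent
    (hXZ : ∀ d, IndepFun (X d) (Z d) (P d))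
    (hXZU : ∀ d, IndepFun (fun ω => (X d ω, Z d ω)) (U d) (P d)) :
    -- the log-acceptance ratio `W_d` converges in distribution to `N(-ℓ⁶/32, ℓ⁶/16)`
    TendstoInDistribution
      (fun d ω => logAcceptanceRatio (stdGaussianDensity d) (stepSize ℓ d) (X d ω)
        (ulaProposal (stdGaussianDensity d) (stepSize ℓ d) (X d ω) (Z d ω)))
      atTop (id : ℝ → ℝ) P (gaussianReal (-ℓ ^ 6 / 32) (ℓ ^ 6 / 16).toNNReal) ∧
    -- the ESJD of the chain is `E[‖x̃ - x‖² α_d(x, x̃)]`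
    (∀ d, expectedSqJump (P d) (X d)
        (fun ω => barkerStep (stdGaussianDensity d) (stepSize ℓ d) (X d ω) (Z d ω) (U d ω)) =
      ∫ ω, ‖X d ω - ulaProposal (stdGaussianDensity d) (stepSize ℓ d) (X d ω) (Z d ω)‖ ^ 2 *
        barkerAcceptance (stdGaussianDensity d) (stepSize ℓ d) (X d ω)
          (ulaProposal (stdGaussianDensity d) (stepSize ℓ d) (X d ω) (Z d ω)) ∂(P d)) ∧
    -- the scaled ESJD converges to `ℓ² A(ℓ)`
    Tendsto
      (fun d : ℕ => (d : ℝ) ^ (-(2 / 3) : ℝ) *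
        expectedSqJump (P d) (X d)
          (fun ω => barkerStep (stdGaussianDensity d) (stepSize ℓ d) (X d ω) (Z d ω) (U d ω)))
      atTop (𝓝 (ℓ ^ 2 * limitAcceptance ℓ)) := by
  refine ⟨tendstoInDistribution_logAcceptanceRatio hℓ hX hZ hXZ, fun d =>
    expectedSqJump_barkerStep hℓ (hX d) (hZ d) (hU d) (hXZ d) (hXZU d), ?_⟩
  refine (tendsto_rpow_mul_integral_norm_sq_mul_barkerAcceptance hℓ hX hZ hXZ).congr fun d => ?_
  rw [expectedSqJump_barkerStep hℓ (hX d) (hZ d) (hU d) (hXZ d) (hXZU d)]
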